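/- For an integer $n\ge 0$ and $S\subseteq\{0,1,\dots,n\}$ let $S+S=\{a+b: a,b\in S\}$, $S-S=\{a-b: a,b\in S\}$ and $$\lambda_n(S)=\bigl(2n+1-|S+S|,\;2n+1-|S-S|\bigr),$$ the pair formed by the number of missing sums and the number of missing differences of $S$. For $\Lambda\subseteq\mathbb{Z}_{\ge 0}\times\mathbb{Z}_{\ge 0}$ let $$\rho_n^\Lambda=2^{-n-1}\,\bigl|\{S\subseteq\{0,1,\dots,n\}:\lambda_n(S)\in\Lambda\}\bigr|,$$ the probability that a uniformly random subset $S$ of $\{0,1,\dots,n\}$ satisfies $\lambda_n(S)\in\Lambda$. Theorem. For every (possibly infinite) $\Lambda\subseteq\mathbb{Z}_{\ge 0}\times\mathbb{Z}_{\ge 0}$ the limit $$\rho^\Lambda=\lim_{n\to\infty}\rho_n^\Lambda$$ exists. It is positive whenever $\Lambda$ contains at least one element $(s,d)$ with $d$ even. Furthermore, $$\rho^\Lambda=\sum_{(s,d)\in\Lambda}\rho^{s,d},$$ where $\rho^{s,d}=\rho^{\{(s,d)\}}$ is the limit for the one-element set $\{(s,d)\}$. -/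

import Mathlib

open Filter Topology
open scoped Pointwise

/-- The pair (number of missing sums, number of missing differences) of a set `S` of integers
contained in `{0, …, n}`. -/
def missing (n : ℕ) (S : Finset ℤ) : ℕ × ℕ :=
  (2 * n + 1 - (S + S).card, 2 * n + 1 - (S - S).card)

/-- No truncation happens in the subtractions of `missing` when `S ⊆ {0, …, n}`. -/
theorem card_add_sub_le (n : ℕ) (S : Finset ℤ) (hS : S ⊆ Finset.Icc (0 : ℤ) n) :
    (S + S).card ≤ 2 * n + 1 ∧ (S - S).card ≤ 2 * n + 1 := by
  constructor
  · have h : S + S ⊆ Finset.Icc (0 : ℤ) (2 * n) := by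
      intro x hx
      obtain ⟨a, ha, b, hb, rfl⟩ := Finset.mem_add.1 hx
      have h1 := Finset.mem_Icc.1 (hS ha)
      have h2 := Finset.mem_Icc.1 (hS hb)
      exact Finset.mem_Icc.2 ⟨by omega, by omega⟩
    have h3 := Finset.card_le_card h
    rw [Int.card_Icc] at h3
    omega
  · have h : S - S ⊆ Finset.Icc (-n : ℤ) n := by
      intro x hx
      obtain ⟨a, ha, b, hb, rfl⟩ := Finset.mem_sub.1 hx
      have h1 := Finset.mem_Icc.1 (hS ha)
      have h2 := Finset.mem_Icc.1 (hS hb)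
      exact Finset.mem_Icc.2 ⟨by omega, by omega⟩
    have h3 := Finset.card_le_card h
    rw [Int.card_Icc] at h3
    omega

open Classical in
/-- The probability that a uniformly random subset `S` of `{0, …, n}` has `missing n S ∈ Λ`. -/
noncomputable def rhoN (Λ : Set (ℕ × ℕ)) (n : ℕ) : ℝ :=
  (((Finset.Icc (0 : ℤ) n).powerset.filter (fun S => missing n S ∈ Λ)).card : ℝ) / 2 ^ (n + 1)

/-- The limit of `rhoN Λ n` as `n → ∞`. -/
noncomputable def rho (Λ : Set (ℕ × ℕ)) : ℝ :=
  limUnder atTop (rhoN Λ)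

/-! A sum near the middle of `[0, 2n]`, or a difference near `0`, has many disjoint representing
pairs, each lying in a random `S` with probability `1/4`. So the probability of a gap at distance
`y` from the extreme sums or differences decays exponentially in `y`. Outside an event of
probability at most `30 * (9/10)^k` (`card_not_rich_le`), every missing sum or difference is within
`k` of an extreme value and is determined by the two fringes of length `k`, whose joint law does not
depend on `n` once `n ≥ 2k` (`card_filter_fringe`). The bound is uniform in `Λ` and `n`, so `rhoN Λ`
is Cauchy. Sets without central gaps have at most `2k` missing sums and at most `2k` missing
differences, so no mass escapes to infinity and `rho` is countably additive.

For positivity at `(s, 2t)`, `exists_fringe` builds fringes `A`, `B`, full from some `N` on, such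
that below `N` the set `A + A` misses `s` numbers, `B + B` none and `A + B` exactly `t`. Differences
near `n` correspond to `A + B`, and each miss counts twice by symmetry. Grafting these fringes onto
a random set without central gaps costs at most a constant factor. -/

/-! ### Fringes with prescribed numbers of missing sums -/

/-- The natural numbers whose residue modulo `8` lies in `U`. -/
def resSet (U : Finset ℕ) : Set ℕ := {x | x % 8 ∈ U}

theorem exists_add_eq_of_residues {U : Finset ℕ}
    (hU : ∀ c < 8, ∃ a ∈ U, ∃ b ∈ U, a < 8 ∧ b < 8 ∧ a + b = c) (x : ℕ) :
    ∃ a ∈ resSet U, ∃ b ∈ resSet U, a + b = x := by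
  obtain ⟨a, ha, b, hb, ha8, hb8, hab⟩ := hU (x % 8) (Nat.mod_lt _ (by norm_num))
  refine ⟨8 * (x / 8) + a, ?_, b, ?_, by omega⟩
  · have : (8 * (x / 8) + a) % 8 = a := by omega
    simpa [resSet, this] using ha
  · have : b % 8 = b := by omega
    simpa [resSet, this] using hb

/-- Two additive bases of order two whose mutual sumset has an infinite complement. -/
theorem exists_bases_infinite_compl : ∃ A B : Set ℕ, 0 ∈ A ∧ 0 ∈ B ∧
    (∀ x, ∃ a ∈ A, ∃ b ∈ A, a + b = x) ∧ (∀ x, ∃ a ∈ B, ∃ b ∈ B, a + b = x) ∧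
    ∀ L, ∃ x ≥ L, ∀ a ∈ A, ∀ b ∈ B, a + b ≠ x := by
  -- Each residue set represents all of `0, …, 7` by exact sums, without wrapping modulo `8`, while
  -- their mixed sums never hit the class of `7`.
  refine ⟨resSet {0, 1, 3, 4}, resSet {0, 1, 2, 5}, by simp [resSet], by simp [resSet],
    exists_add_eq_of_residues (by decide), exists_add_eq_of_residues (by decide), fun L => ?_⟩
  refine ⟨8 * L + 7, by omega, fun a ha b hb => ?_⟩
  simp only [resSet, Finset.mem_insert, Finset.mem_singleton, Set.mem_ofPred_eq] at ha hb
  omega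

/-- As `exists_bases_infinite_compl`, with the first sumset missing exactly `1, …, s`. -/
theorem exists_bases_missing (s : ℕ) : ∃ A B : Set ℕ, 0 ∈ A ∧ 0 ∈ B ∧
    (∀ x, (∃ a ∈ A, ∃ b ∈ A, a + b = x) ↔ x = 0 ∨ s < x) ∧
    (∀ x, ∃ a ∈ B, ∃ b ∈ B, a + b = x) ∧
    (∀ x ≤ s, x ∈ B) ∧ ∀ L, ∃ x ≥ L, ∀ a ∈ A, ∀ b ∈ B, a + b ≠ x := by
  obtain ⟨A, B, hA0, hB0, hA, hB, hAB⟩ := exists_bases_infinite_compl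
  have hdiv : ∀ q i, i ≤ s → ((s + 1) * q + i) / (s + 1) = q := fun q i hi => by
    rw [Nat.mul_add_div (by omega), Nat.div_eq_of_lt (by omega), add_zero]
  have hdm : ∀ x, (s + 1) * (x / (s + 1)) + x % (s + 1) = x := fun x => Nat.div_add_mod _ _
  have hml : ∀ x, x % (s + 1) ≤ s := fun x => Nat.le_of_lt_succ (Nat.mod_lt _ (by omega))
  -- Each integer is inflated to a block of length `s + 1`; then `1, …, s` are deleted from the
  -- first set. Its nonzero elements now exceed `s`, so its sums skip `1, …, s`.
  refine ⟨{x | x = 0 ∨ s < x ∧ x / (s + 1) ∈ A}, {x | x / (s + 1) ∈ B}, by simp, by simpa,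
    fun x => ⟨?_, ?_⟩, fun x => ?_, fun x hx => ?_, fun L => ?_⟩
  · rintro ⟨a, ha, b, hb, rfl⟩
    simp only [Set.mem_ofPred_eq] at ha hb
    omega
  · rintro (rfl | hx)
    · exact ⟨0, by simp, 0, by simp, rfl⟩
    obtain ⟨a, ha, b, hb, hab⟩ := hA (x / (s + 1))
    have hq : 1 ≤ x / (s + 1) := (Nat.one_le_div_iff (by omega)).2 hx
    have hx' := hdm x
    rw [← hab] at hx' hq
    rcases Nat.eq_zero_or_pos a with rfl | ha0
    · refine ⟨0, by simp, x, Or.inr ⟨hx, ?_⟩, by simp⟩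
      rw [← hab]; simpa using hb
    rcases Nat.eq_zero_or_pos b with rfl | hb0
    · refine ⟨x, Or.inr ⟨hx, ?_⟩, 0, by simp, by simp⟩
      rw [← hab]; simpa using ha
    refine ⟨(s + 1) * a + 0, Or.inr ⟨?_, ?_⟩, (s + 1) * b + x % (s + 1), Or.inr ⟨?_, ?_⟩, ?_⟩
    · nlinarith
    · rwa [hdiv _ _ (by omega)]
    · nlinarith [Nat.zero_le (x % (s + 1))]
    · rwa [hdiv _ _ (hml x)]
    · linarith
  · obtain ⟨a, ha, b, hb, hab⟩ := hB (x / (s + 1))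
    refine ⟨(s + 1) * a + 0, ?_, (s + 1) * b + x % (s + 1), ?_, ?_⟩
    · rwa [Set.mem_ofPred_eq, hdiv _ _ (by omega)]
    · rwa [Set.mem_ofPred_eq, hdiv _ _ (hml x)]
    · have := hdm x
      rw [← hab] at this
      linarith
  · rwa [Set.mem_ofPred_eq, Nat.div_eq_of_lt (by omega)]
  · obtain ⟨r, hr, h⟩ := hAB L
    -- The last element of block `r` works: two remainders add to at most `2s`, so a sum with
    -- remainder `s` involves no carry, and the block indices of its summands add to `r`.
    refine ⟨(s + 1) * r + s, by nlinarith, ?_⟩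
    rintro a ha b hb hab
    simp only [Set.mem_ofPred_eq] at ha hb
    have ha' : a / (s + 1) ∈ A := by
      rcases ha with rfl | ha
      · simpa
      · exact ha.2
    apply h _ ha' _ hb
    have h1 := hdm a
    have h2 := hdm b
    have h3 := hml a
    have h4 := hml b
    generalize a / (s + 1) = p at *
    generalize b / (s + 1) = q at *
    rcases lt_trichotomy (p + q) r with hlt | heq | hgt
    · have h5 : (s + 1) * (p + q + 1) ≤ (s + 1) * r := Nat.mul_le_mul_left _ hlt
      nlinarith
    · exact heq
    · have h5 : (s + 1) * (r + 1) ≤ (s + 1) * (p + q) := Nat.mul_le_mul_left _ hgt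
      nlinarith [Nat.zero_le (a % (s + 1)), Nat.zero_le (b % (s + 1))]

/-- The number of elements of `{0, …, k - 1}` missing from `A + B`. -/
noncomputable def miss (k : ℕ) (A B : Finset ℤ) : ℕ := (Finset.Ico (0 : ℤ) k \ (A + B)).card

-- The count below `N` grows by one each time `N` passes an element of the infinite set, so it takes
-- every value. It serves to cut off the mixed sumset after exactly `t` gaps.
open Classical in
theorem exists_step {p : ℕ → Prop} (hp : ∀ L, ∃ x ≥ L, p x) {M : ℕ} (h0 : ∀ x < M, ¬ p x) (t : ℕ) :
    ∃ N ≥ M, ((Finset.range N).filter p).card = t := by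
  induction t with
  | zero =>
    refine ⟨M, le_rfl, ?_⟩
    rw [Finset.card_eq_zero, Finset.filter_eq_empty_iff]
    exact fun x hx => h0 x (Finset.mem_range.1 hx)
  | succ t ih =>
    obtain ⟨N, hN, hc⟩ := ih
    have hex : ∃ x, N ≤ x ∧ p x := by obtain ⟨x, h1, h2⟩ := hp N; exact ⟨x, h1, h2⟩
    refine ⟨Nat.find hex + 1, by have := (Nat.find_spec hex).1; omega, ?_⟩
    have hset : (Finset.range (Nat.find hex + 1)).filter p =
        insert (Nat.find hex) ((Finset.range N).filter p) := by
      ext x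
      simp only [Finset.mem_filter, Finset.mem_range, Finset.mem_insert]
      constructor
      · rintro ⟨hx, hpx⟩
        by_cases hxN : x < N
        · exact Or.inr ⟨hxN, hpx⟩
        · have := Nat.find_min' hex ⟨not_lt.1 hxN, hpx⟩
          left; omega
      · rintro (rfl | ⟨hx, hpx⟩)
        · exact ⟨by omega, (Nat.find_spec hex).2⟩
        · exact ⟨by have := (Nat.find_spec hex).1; omega, hpx⟩
    rw [hset, Finset.card_insert_of_notMem, hc]
    have := (Nat.find_spec hex).1
    simp only [Finset.mem_filter, Finset.mem_range]
    omega

open Classical in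
/-- The trace on `{0, …, k - 1}` of a set of natural numbers, as a finite set of integers. -/
noncomputable def trace (k : ℕ) (A : Set ℕ) : Finset ℤ :=
  (Finset.Ico (0 : ℤ) k).filter (fun x => x.toNat ∈ A)

open Classical in
theorem miss_trace (k : ℕ) (A B : Set ℕ) : miss k (trace k A) (trace k B) =
    ((Finset.range k).filter (fun x => ∀ a ∈ A, ∀ b ∈ B, a + b ≠ x)).card := by
  unfold miss
  apply Finset.card_nbij' Int.toNat (fun x : ℕ => (x : ℤ))
  · intro x hx
    simp only [Finset.coe_sdiff, Set.mem_sdiff, Finset.mem_coe, Finset.mem_Ico, Finset.mem_add, trace,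
      Finset.mem_filter, Finset.mem_range, not_exists, not_and] at hx ⊢
    refine ⟨by omega, fun a ha b hb hab => ?_⟩
    exact hx.2 a ⟨by omega, by simpa⟩ b ⟨by omega, by simpa⟩ (by omega)
  · intro x hx
    simp only [Finset.coe_sdiff, Set.mem_sdiff, Finset.mem_coe, Finset.mem_Ico, Finset.mem_add, trace,
      Finset.mem_filter, Finset.mem_range, not_exists, not_and] at hx ⊢
    refine ⟨by omega, fun a ha b hb hab => ?_⟩
    exact hx.2 _ ha.2 _ hb.2 (by omega)
  · intro x hx
    simp only [Finset.coe_sdiff, Set.mem_sdiff, Finset.mem_coe, Finset.mem_Ico] at hx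
    exact Int.toNat_of_nonneg hx.1.1
  · intro x _
    simp

/-- Fringes realizing any prescribed numbers of missing sums and differences. -/
theorem exists_fringe (s t : ℕ) : ∃ (N : ℕ) (A B : Set ℕ), 0 ∈ A ∧ 0 ∈ B ∧
    (∀ x ≥ N, x ∈ A ∧ x ∈ B) ∧ miss N (trace N A) (trace N A) = s ∧
    miss N (trace N B) (trace N B) = 0 ∧ miss N (trace N A) (trace N B) = t := by
  classical
  obtain ⟨A, B, hA0, hB0, hA, hB, hBs, hAB⟩ := exists_bases_missing s
  -- As `0 ∈ A` and `B` contains `0, …, s`, no mixed sum up to `s` is missing. Starting at `s + 1`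
  -- also puts all `s` gaps of `A + A` below `N`.
  obtain ⟨N, hN, hcard⟩ := exists_step hAB (M := s + 1)
    (fun x hx h => h 0 hA0 x (hBs x (by omega)) (by simp)) t
  have key : ∀ C D : Set ℕ, miss N (trace N (C ∪ {x | N ≤ x})) (trace N (D ∪ {x | N ≤ x})) =
      ((Finset.range N).filter (fun x => ∀ a ∈ C, ∀ b ∈ D, a + b ≠ x)).card := by
    intro C D
    rw [miss_trace]
    congr 1
    apply Finset.filter_congr
    intro x hx
    have hx := Finset.mem_range.1 hx
    constructor
    · exact fun h a ha b hb => h a (Or.inl ha) b (Or.inl hb)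
    · rintro h a (ha | ha) b (hb | hb)
      · exact h a ha b hb
      all_goals simp only [Set.mem_ofPred_eq] at *; omega
  refine ⟨N, A ∪ {x | N ≤ x}, B ∪ {x | N ≤ x}, Or.inl hA0, Or.inl hB0,
    fun x hx => ⟨Or.inr hx, Or.inr hx⟩, ?_, ?_, ?_⟩
  · rw [key]
    have : (Finset.range N).filter (fun x => ∀ a ∈ A, ∀ b ∈ A, a + b ≠ x) = Finset.Icc 1 s := by
      ext x
      have := hA x
      simp only [Finset.mem_filter, Finset.mem_range, Finset.mem_Icc]
      constructor
      · rintro ⟨hx, h⟩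
        by_contra hc
        obtain ⟨a, ha, b, hb, hab⟩ := this.2 (by omega)
        exact h a ha b hb hab
      · rintro ⟨h1, h2⟩
        refine ⟨by omega, fun a ha b hb hab => ?_⟩
        have := this.1 ⟨a, ha, b, hb, hab⟩
        omega
    rw [this]; simp
  · rw [key, Finset.card_eq_zero, Finset.filter_eq_empty_iff]
    intro x _ h
    obtain ⟨a, ha, b, hb, hab⟩ := hB x
    exact h a ha b hb hab
  · rw [key, hcard]

/-! ### Exponential bound for central gaps -/

/-- Subsets of `X` containing none of the disjoint pairs `{i, f i}`. -/
theorem card_avoid_pairs_mul_le (f : ℤ → ℤ) (I : Finset ℤ) : ∀ X : Finset ℤ, I ⊆ X →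
    (∀ i ∈ I, f i ∈ X) → (∀ i ∈ I, f i ∉ I) → Set.InjOn f I →
    (X.powerset.filter (fun S => ∀ i ∈ I, ¬ (i ∈ S ∧ f i ∈ S))).card * 4 ^ I.card ≤
      3 ^ I.card * 2 ^ X.card := by
  induction I using Finset.induction_on with
  | empty => intro X _ _ _ _; simp
  | insert j I hj ih =>
    intro X hIX hfX hfI hinj
    have hjX : j ∈ X := hIX (Finset.mem_insert_self _ _)
    have hfj : f j ∈ X := hfX j (Finset.mem_insert_self _ _)
    have hne : f j ≠ j := fun h => hfI j (Finset.mem_insert_self _ _) (by rw [h]; simp)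
    have hfjI : f j ∉ I := fun h => hfI j (Finset.mem_insert_self _ _) (Finset.mem_insert_of_mem h)
    have hcard : (X \ {j, f j}).card + 2 = X.card := by
      rw [← Finset.card_pair hne.symm]
      exact Finset.card_sdiff_add_card_eq_card (by
        intro x hx; rcases Finset.mem_insert.1 hx with rfl | hx
        · exact hjX
        · rwa [Finset.mem_singleton.1 hx])
    have h := ih (X \ {j, f j})
      (fun i hi => Finset.mem_sdiff.2 ⟨hIX (Finset.mem_insert_of_mem hi), by
        simp only [Finset.mem_insert, Finset.mem_singleton, not_or]
        exact ⟨fun h => hj (h ▸ hi), fun h => hfjI (h ▸ hi)⟩⟩)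
      (fun i hi => Finset.mem_sdiff.2 ⟨hfX i (Finset.mem_insert_of_mem hi), by
        simp only [Finset.mem_insert, Finset.mem_singleton, not_or]
        refine ⟨fun h => hfI i (Finset.mem_insert_of_mem hi) (by rw [h]; simp), fun h => ?_⟩
        have := hinj (by simp [hi]) (by simp) h
        exact hj (this ▸ hi)⟩)
      (fun i hi h => hfI i (Finset.mem_insert_of_mem hi) (Finset.mem_insert_of_mem h))
      (hinj.mono (by simp))
    -- Splitting off the trace on `{j, f j}` leaves three of its four subsets, whence a factor `3/4`
    -- per pair.
    have hinjcard : (X.powerset.filter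
          (fun S => ∀ i ∈ insert j I, ¬ (i ∈ S ∧ f i ∈ S))).card ≤
        (((X \ {j, f j}).powerset.filter (fun S => ∀ i ∈ I, ¬ (i ∈ S ∧ f i ∈ S))) ×ˢ
          (({j, f j} : Finset ℤ).powerset.erase {j, f j})).card := by
      apply Finset.card_le_card_of_injOn (fun S => (S \ {j, f j}, S ∩ {j, f j}))
      · intro S hS
        simp only [Finset.coe_filter, Finset.mem_powerset, Set.mem_ofPred_eq] at hS
        simp only [Finset.coe_product, Set.mem_prod, Finset.mem_coe, Finset.mem_filter,
          Finset.mem_powerset, Finset.mem_erase]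
        refine ⟨⟨Finset.sdiff_subset_sdiff hS.1 subset_rfl, fun i hi h => ?_⟩, fun h => ?_,
          Finset.inter_subset_right⟩
        · exact hS.2 i (Finset.mem_insert_of_mem hi)
            ⟨(Finset.mem_sdiff.1 h.1).1, (Finset.mem_sdiff.1 h.2).1⟩
        · rw [Finset.inter_eq_right] at h
          exact hS.2 j (Finset.mem_insert_self _ _) ⟨h (by simp), h (by simp)⟩
      · intro S _ T _ h
        simp only [Prod.mk.injEq] at h
        rw [← Finset.sdiff_union_inter S {j, f j}, h.1, h.2, Finset.sdiff_union_inter]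
    rw [Finset.card_product, Finset.card_erase_of_mem (by simp), Finset.card_powerset,
      Finset.card_pair hne.symm] at hinjcard
    rw [Finset.card_insert_of_notMem hj, ← hcard, pow_succ, pow_succ, pow_add]
    calc _ ≤ _ * (2 ^ 2 - 1) * (4 ^ I.card * 4) := Nat.mul_le_mul_right _ hinjcard
      _ = (_ * 4 ^ I.card) * 12 := by ring
      _ ≤ (3 ^ I.card * 2 ^ (X \ {j, f j}).card) * 12 := Nat.mul_le_mul_right _ h
      _ = _ := by ring

theorem card_avoid_pairs_le (f : ℤ → ℤ) (n : ℕ) (I : Finset ℤ) (e : ℕ) (p : Finset ℤ → Prop)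
    [DecidablePred p]
    (hI : ∀ i ∈ I, 0 ≤ i ∧ i ≤ n ∧ 0 ≤ f i ∧ f i ≤ n) (hf : ∀ i ∈ I, f i ∉ I)
    (hinj : Set.InjOn f I) (he : e ≤ 2 * I.card)
    (hp : ∀ S, p S → ∀ i ∈ I, ¬ (i ∈ S ∧ f i ∈ S)) :
    (((Finset.Icc (0 : ℤ) n).powerset.filter p).card : ℝ) ≤ 2 ^ (n + 1) * (9 / 10) ^ e := by
  have h := card_avoid_pairs_mul_le f I (Finset.Icc (0 : ℤ) n)
    (fun i hi => Finset.mem_Icc.2 ⟨(hI i hi).1, (hI i hi).2.1⟩)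
    (fun i hi => Finset.mem_Icc.2 (hI i hi).2.2) hf hinj
  have hX : (Finset.Icc (0 : ℤ) n).card = n + 1 := by simp [Int.card_Icc]
  rw [hX] at h
  have hle : ((Finset.Icc (0 : ℤ) n).powerset.filter p).card ≤ ((Finset.Icc (0 : ℤ) n).powerset.filter
      (fun S => ∀ i ∈ I, ¬ (i ∈ S ∧ f i ∈ S))).card :=
    Finset.card_le_card (Finset.monotone_filter_right _ (fun S _ h => hp S h))
  set c := ((Finset.Icc (0 : ℤ) n).powerset.filter (fun S => ∀ i ∈ I, ¬ (i ∈ S ∧ f i ∈ S))).card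
  have hc : (c : ℝ) * 4 ^ I.card ≤ 3 ^ I.card * 2 ^ (n + 1) := by exact_mod_cast h
  have h4 : (0 : ℝ) < 4 ^ I.card := by positivity
  -- Since `3/4 ≤ (9/10)^2`, a factor per pair becomes a factor per element, which absorbs the
  -- halving in the choice of pairs.
  have h34 : (3 / 4 : ℝ) ^ I.card ≤ (9 / 10) ^ e :=
    calc (3 / 4 : ℝ) ^ I.card ≤ ((9 / 10) ^ 2) ^ I.card := by gcongr; norm_num
      _ = (9 / 10) ^ (2 * I.card) := by rw [pow_mul]
      _ ≤ (9 / 10) ^ e := pow_le_pow_of_le_one (by norm_num) (by norm_num) he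
  calc _ ≤ (c : ℝ) := by exact_mod_cast hle
    _ ≤ 3 ^ I.card * 2 ^ (n + 1) / 4 ^ I.card := by rwa [le_div_iff₀ h4]
    _ = 2 ^ (n + 1) * (3 / 4) ^ I.card := by rw [div_pow]; ring
    _ ≤ _ := by gcongr

/-- All sums in `[K, 2n - K]` and all differences of absolute value at most `n - K` are realized by
elements of `S` in `[N, n - N]`. -/
def Rich (N K n : ℕ) (S : Finset ℤ) : Prop :=
  (∀ x : ℤ, K ≤ x → x ≤ 2 * n - K → ∃ a ∈ S ∩ Finset.Icc (N : ℤ) (n - N),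
    ∃ b ∈ S ∩ Finset.Icc (N : ℤ) (n - N), a + b = x) ∧
  ∀ x : ℤ, 0 ≤ x → x ≤ n - K → ∃ a ∈ S ∩ Finset.Icc (N : ℤ) (n - N),
    ∃ b ∈ S ∩ Finset.Icc (N : ℤ) (n - N), a - b = x

section

variable (N n y : ℕ) (p : Finset ℤ → Prop) [DecidablePred p]

theorem card_missing_low_sum (hy : 2 * N ≤ y) (hyn : y ≤ n)
    (hp : ∀ S, p S → ¬ ∃ a ∈ S ∩ Finset.Icc (N : ℤ) (n - N),
      ∃ b ∈ S ∩ Finset.Icc (N : ℤ) (n - N), a + b = y) :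
    (((Finset.Icc (0 : ℤ) n).powerset.filter p).card : ℝ) ≤
      2 ^ (n + 1) * (9 / 10) ^ (y - 2 * N) := by
  apply card_avoid_pairs_le (fun i => y - i) n (Finset.Ico (N : ℤ) ((y + 1) / 2))
  · intro i hi
    rw [Finset.mem_Ico] at hi
    omega
  · intro i hi
    rw [Finset.mem_Ico] at hi ⊢
    omega
  · intro i _ j _ h
    simpa using h
  · rw [Int.card_Ico]
    omega
  · rintro S h i hi ⟨h1, h2⟩
    replace h := hp S h
    rw [Finset.mem_Ico] at hi
    refine h ⟨i, ?_, y - i, ?_, by ring⟩ <;> rw [Finset.mem_inter, Finset.mem_Icc]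
    · exact ⟨h1, by omega⟩
    · exact ⟨h2, by omega⟩

theorem card_missing_high_sum (hy : 2 * N ≤ y) (hyn : y ≤ n)
    (hp : ∀ S, p S → ¬ ∃ a ∈ S ∩ Finset.Icc (N : ℤ) (n - N),
      ∃ b ∈ S ∩ Finset.Icc (N : ℤ) (n - N), a + b = 2 * n - y) :
    (((Finset.Icc (0 : ℤ) n).powerset.filter p).card : ℝ) ≤
      2 ^ (n + 1) * (9 / 10) ^ (y - 2 * N) := by
  apply card_avoid_pairs_le (fun i => 2 * n - y - i) n
    (Finset.Ioc (n - (y + 1) / 2 : ℤ) (n - N))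
  · intro i hi
    rw [Finset.mem_Ioc] at hi
    omega
  · intro i hi
    rw [Finset.mem_Ioc] at hi ⊢
    omega
  · intro i _ j _ h
    simpa using h
  · rw [Int.card_Ioc]
    omega
  · rintro S h i hi ⟨h1, h2⟩
    replace h := hp S h
    rw [Finset.mem_Ioc] at hi
    refine h ⟨i, ?_, 2 * n - y - i, ?_, by ring⟩ <;> rw [Finset.mem_inter, Finset.mem_Icc]
    · exact ⟨h1, by omega⟩
    · exact ⟨h2, by omega⟩

/-- The pairs `{i, i + d}` with `d = n - y` overlap along chains. Keeping only the `i` for which `(i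
- N) / d` is even makes them disjoint and retains at least half. Difference `0` is excluded, as its
pairs degenerate. -/
theorem card_missing_difference (hy : 2 * N ≤ y) (hyn : y < n)
    (hp : ∀ S, p S → ¬ ∃ a ∈ S ∩ Finset.Icc (N : ℤ) (n - N),
      ∃ b ∈ S ∩ Finset.Icc (N : ℤ) (n - N), a - b = n - y) :
    (((Finset.Icc (0 : ℤ) n).powerset.filter p).card : ℝ) ≤
      2 ^ (n + 1) * (9 / 10) ^ (y - 2 * N) := by
  have hdiv : ∀ i : ℤ, (i + (n - y) - N) / (n - y) = (i - N) / (n - y) + 1 := fun i => by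
    rw [show i + (n - y) - N = (i - N) + 1 * (n - y : ℤ) by ring,
      Int.add_mul_ediv_right _ _ (by omega)]
  -- An index with odd quotient is the shift by `d` of one with even quotient, so the selected
  -- indices and their shifts cover the interval.
  have hJ : Finset.Icc (N : ℤ) (y - N) ⊆
      ((Finset.Icc (N : ℤ) (y - N)).filter (fun i => Even ((i - N) / (n - y : ℤ)))) ∪
      ((Finset.Icc (N : ℤ) (y - N)).filter (fun i => Even ((i - N) / (n - y : ℤ)))).image
        (fun i => i + (n - y : ℤ)) := by
    intro i hi
    rw [Finset.mem_union, Finset.mem_filter, Finset.mem_image]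
    by_cases he : Even ((i - N) / (n - y : ℤ))
    · exact Or.inl ⟨hi, he⟩
    right
    refine ⟨i - (n - y), ?_, by ring⟩
    have h1 := hdiv (i - (n - y))
    rw [show i - (n - y) + (n - y) - (N : ℤ) = i - N by ring] at h1
    rw [h1, Int.even_add_one, not_not] at he
    rw [Finset.mem_Icc] at hi
    have h2 : (n - y : ℤ) ≤ i - N := by
      by_contra hlt
      rw [Int.ediv_eq_zero_of_lt (by omega) (by omega)] at h1
      rw [show (i - (n - y) - N) / (n - y : ℤ) = -1 by omega] at he
      exact absurd he (by decide)
    rw [Finset.mem_filter, Finset.mem_Icc]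
    exact ⟨by omega, he⟩
  apply card_avoid_pairs_le (fun i => i + (n - y)) n
    ((Finset.Icc (N : ℤ) (y - N)).filter (fun i => Even ((i - N) / (n - y : ℤ))))
  · intro i hi
    rw [Finset.mem_filter, Finset.mem_Icc] at hi
    omega
  · intro i hi h
    rw [Finset.mem_filter, hdiv, Int.even_add_one] at h
    exact h.2 (Finset.mem_filter.1 hi).2
  · intro i _ j _ h
    simpa using h
  · have h1 := (Finset.card_le_card hJ).trans (Finset.card_union_le _ _)
    have h2 := Finset.card_image_le (f := fun i => i + (n - y : ℤ))
      (s := (Finset.Icc (N : ℤ) (y - N)).filter (fun i => Even ((i - N) / (n - y : ℤ))))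
    rw [Int.card_Icc] at h1
    omega
  · rintro S h i hi ⟨h1, h2⟩
    replace h := hp S h
    rw [Finset.mem_filter, Finset.mem_Icc] at hi
    refine h ⟨i + (n - y), ?_, i, ?_, by ring⟩ <;> rw [Finset.mem_inter, Finset.mem_Icc]
    · exact ⟨h2, by omega⟩
    · exact ⟨h1, by omega⟩

end

theorem sum_geometric_tail_le (N K n : ℕ) (hK : 2 * N ≤ K) :
    ∑ y ∈ Finset.Icc K n, (9 / 10 : ℝ) ^ (y - 2 * N) ≤ 10 * (9 / 10) ^ (K - 2 * N) := by
  have h : ∀ m, ∑ y ∈ Finset.Ico K (K + m), (9 / 10 : ℝ) ^ (y - 2 * N) =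
      10 * (9 / 10) ^ (K - 2 * N) - 10 * (9 / 10) ^ (K + m - 2 * N) := by
    intro m
    induction m with
    | zero => simp
    | succ m ih =>
      rw [← add_assoc, Finset.sum_Ico_succ_top (by omega), ih,
        show K + m + 1 - 2 * N = (K + m - 2 * N) + 1 by omega, pow_succ]
      ring
  have h2 := h (n + 1)
  have h3 : ∑ y ∈ Finset.Icc K n, (9 / 10 : ℝ) ^ (y - 2 * N) ≤
      ∑ y ∈ Finset.Ico K (K + (n + 1)), (9 / 10 : ℝ) ^ (y - 2 * N) :=
    Finset.sum_le_sum_of_subset_of_nonneg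
      (fun y hy => by rw [Finset.mem_Icc] at hy; rw [Finset.mem_Ico]; omega)
      (fun _ _ _ => by positivity)
  have h4 : (0 : ℝ) < (9 / 10) ^ (K + (n + 1) - 2 * N) := by positivity
  linarith

-- A union bound over the distance `y` from the extremes, with three events for each `y` and
-- geometric factor `10`; hence the constant `30`.
open Classical in
theorem card_not_rich_le (N K n : ℕ) (hK : 2 * N ≤ K) (hn : K ≤ n) :
    (((Finset.Icc (0 : ℤ) n).powerset.filter (fun S => ¬ Rich N K n S)).card : ℝ) ≤
      2 ^ (n + 1) * (30 * (9 / 10) ^ (K - 2 * N)) := by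
  set P := (Finset.Icc (0 : ℤ) n).powerset
  let R : Finset ℤ → Finset ℤ := fun S => S ∩ Finset.Icc (N : ℤ) (n - N)
  let p1 : ℕ → Finset ℤ → Prop := fun y S => ¬ ∃ a ∈ R S, ∃ b ∈ R S, a + b = y
  let p2 : ℕ → Finset ℤ → Prop := fun y S => ¬ ∃ a ∈ R S, ∃ b ∈ R S, a + b = 2 * n - y
  let p3 : ℕ → Finset ℤ → Prop := fun y S => y < n ∧ ¬ ∃ a ∈ R S, ∃ b ∈ R S, a - b = n - y
  have hsub : P.filter (fun S => ¬ Rich N K n S) ⊆ (Finset.Icc K n).biUnion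
      (fun y => P.filter (p1 y) ∪ (P.filter (p2 y) ∪ P.filter (p3 y))) := by
    intro S hS
    rw [Finset.mem_filter] at hS
    by_contra hcon
    apply hS.2
    simp only [Finset.mem_biUnion, Finset.mem_union, Finset.mem_filter, hS.1, true_and, not_exists,
      not_and, not_or, Finset.mem_Icc] at hcon
    have hsum : ∀ x : ℤ, K ≤ x → x ≤ 2 * n - K → ∃ a ∈ R S, ∃ b ∈ R S, a + b = x := by
      intro x hx1 hx2
      rcases le_total x n with hxn | hxn
      · have := not_not.1 (hcon x.toNat ⟨by omega, by omega⟩).1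
        rwa [Int.toNat_of_nonneg (by omega)] at this
      · have := not_not.1 (hcon (2 * n - x).toNat ⟨by omega, by omega⟩).2.1
        rwa [Int.toNat_of_nonneg (by omega), sub_sub_cancel] at this
    refine ⟨hsum, fun x hx1 hx2 => ?_⟩
    rcases eq_or_lt_of_le hx1 with rfl | hx
    -- Difference `0` only needs a nonempty centre, and a representation of the sum `n` supplies an
    -- element.
    · obtain ⟨a, ha, -⟩ := hsum n (by omega) (by omega)
      exact ⟨a, ha, a, ha, by ring⟩
    · have h := (hcon (n - x).toNat ⟨by omega, by omega⟩).2.2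
      have h' := not_not.1 (fun h2 => h ⟨by omega, h2⟩)
      rwa [Int.toNat_of_nonneg (by omega), sub_sub_cancel] at h'
  have hbound : ∀ y ∈ Finset.Icc K n,
      ((P.filter (p1 y) ∪ (P.filter (p2 y) ∪ P.filter (p3 y))).card : ℝ) ≤
        2 ^ (n + 1) * 3 * (9 / 10) ^ (y - 2 * N) := by
    intro y hy
    rw [Finset.mem_Icc] at hy
    have h1 : ((P.filter (p1 y)).card : ℝ) ≤ 2 ^ (n + 1) * (9 / 10) ^ (y - 2 * N) :=
      card_missing_low_sum N n y _ (by omega) (by omega) (fun _ h => h)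
    have h2 : ((P.filter (p2 y)).card : ℝ) ≤ 2 ^ (n + 1) * (9 / 10) ^ (y - 2 * N) :=
      card_missing_high_sum N n y _ (by omega) (by omega) (fun _ h => h)
    have h3 : ((P.filter (p3 y)).card : ℝ) ≤ 2 ^ (n + 1) * (9 / 10) ^ (y - 2 * N) := by
      by_cases hyn : y < n
      · exact card_missing_difference N n y _ (by omega) hyn (fun _ h => h.2)
      · rw [Finset.filter_false_of_mem (fun S _ h => hyn h.1)]
        simp only [Finset.card_empty, Nat.cast_zero]
        positivity
    have h4 : ((P.filter (p1 y) ∪ (P.filter (p2 y) ∪ P.filter (p3 y))).card : ℝ) ≤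
        (P.filter (p1 y)).card + ((P.filter (p2 y)).card + (P.filter (p3 y)).card) := by
      exact_mod_cast (Finset.card_union_le _ _).trans
        (Nat.add_le_add_left (Finset.card_union_le _ _) _)
    linarith
  calc _ ≤ (((Finset.Icc K n).biUnion
      (fun y => P.filter (p1 y) ∪ (P.filter (p2 y) ∪ P.filter (p3 y)))).card : ℝ) := by
        exact_mod_cast Finset.card_le_card hsub
    _ ≤ ∑ y ∈ Finset.Icc K n,
        ((P.filter (p1 y) ∪ (P.filter (p2 y) ∪ P.filter (p3 y))).card : ℝ) := by
        exact_mod_cast Finset.card_biUnion_le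
    _ ≤ ∑ y ∈ Finset.Icc K n, 2 ^ (n + 1) * 3 * (9 / 10 : ℝ) ^ (y - 2 * N) :=
        Finset.sum_le_sum hbound
    _ ≤ 2 ^ (n + 1) * 3 * (10 * (9 / 10) ^ (K - 2 * N)) := by
        rw [← Finset.mul_sum]
        gcongr
        exact sum_geometric_tail_le N K n hK
    _ = _ := by ring

/-! ### Missing sums and differences read off from the fringes -/

/-- The reflection `n - S`. -/
def reflect (n : ℕ) (S : Finset ℤ) : Finset ℤ := S.image (fun x => n - x)

theorem mem_reflect {n : ℕ} {S : Finset ℤ} {x : ℤ} : x ∈ reflect n S ↔ (n : ℤ) - x ∈ S := by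
  simp only [reflect, Finset.mem_image]
  constructor
  · rintro ⟨a, ha, rfl⟩
    simpa using ha
  · exact fun h => ⟨_, h, by ring⟩

theorem mem_reflect_add_reflect {n : ℕ} {S : Finset ℤ} {x : ℤ} :
    x ∈ reflect n S + reflect n S ↔ 2 * (n : ℤ) - x ∈ S + S := by
  simp only [Finset.mem_add, mem_reflect]
  constructor
  · rintro ⟨a, ha, b, hb, rfl⟩
    exact ⟨_, ha, _, hb, by ring⟩
  · rintro ⟨a, ha, b, hb, h⟩
    exact ⟨n - a, by simpa, n - b, by simpa, by linarith⟩

theorem mem_add_reflect {n : ℕ} {S : Finset ℤ} {x : ℤ} :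
    x ∈ S + reflect n S ↔ (n : ℤ) - x ∈ S - S := by
  simp only [Finset.mem_add, Finset.mem_sub, mem_reflect]
  constructor
  · rintro ⟨a, ha, b, hb, rfl⟩
    exact ⟨_, hb, _, ha, by ring⟩
  · rintro ⟨a, ha, b, hb, h⟩
    exact ⟨b, hb, n - a, by simpa, by linarith⟩

theorem neg_mem_sub_self {S : Finset ℤ} {x : ℤ} : -x ∈ S - S ↔ x ∈ S - S := by
  simp only [Finset.mem_sub]
  constructor <;> rintro ⟨a, ha, b, hb, h⟩ <;> exact ⟨b, hb, a, ha, by linarith⟩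

theorem miss_le (k : ℕ) (A B : Finset ℤ) : miss k A B ≤ k := by
  simpa [miss] using Finset.card_le_card
    (Finset.sdiff_subset : Finset.Ico (0 : ℤ) k \ (A + B) ⊆ _)

theorem miss_inter {k : ℕ} {A B : Finset ℤ} (hA : ∀ x ∈ A, 0 ≤ x) (hB : ∀ x ∈ B, 0 ≤ x) :
    miss k (A ∩ Finset.Ico 0 k) (B ∩ Finset.Ico 0 k) = miss k A B := by
  unfold miss
  congr 1
  ext x
  simp only [Finset.mem_sdiff, Finset.mem_Ico, Finset.mem_add, Finset.mem_inter]
  refine and_congr_right fun hx => not_congr ⟨?_, ?_⟩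
  · rintro ⟨a, ha, b, hb, h⟩
    exact ⟨a, ha.1, b, hb.1, h⟩
  · rintro ⟨a, ha, b, hb, h⟩
    have := hA a ha
    have := hB b hb
    exact ⟨a, ⟨ha, by omega⟩, b, ⟨hb, by omega⟩, h⟩

/-- The missing sums and differences of a set without central gaps are those of its two fringes. -/
theorem missing_eq_of_central {k n : ℕ} (hk : k ≤ n) {S : Finset ℤ} (hS : S ⊆ Finset.Icc (0 : ℤ) n)
    (hsum : ∀ x : ℤ, k ≤ x → x ≤ 2 * n - k → x ∈ S + S)
    (hdiff : ∀ x : ℤ, 0 ≤ x → x ≤ n - k → x ∈ S - S) :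
    missing n S = (miss k S S + miss k (reflect n S) (reflect n S), 2 * miss k S (reflect n S)) := by
  have hadd : S + S ⊆ Finset.Icc (0 : ℤ) (2 * n) := by
    intro x hx
    obtain ⟨a, ha, b, hb, rfl⟩ := Finset.mem_add.1 hx
    have h1 := Finset.mem_Icc.1 (hS ha)
    have h2 := Finset.mem_Icc.1 (hS hb)
    exact Finset.mem_Icc.2 ⟨by omega, by omega⟩
  have hsub : S - S ⊆ Finset.Icc (-n : ℤ) n := by
    intro x hx
    obtain ⟨a, ha, b, hb, rfl⟩ := Finset.mem_sub.1 hx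
    have h1 := Finset.mem_Icc.1 (hS ha)
    have h2 := Finset.mem_Icc.1 (hS hb)
    exact Finset.mem_Icc.2 ⟨by omega, by omega⟩
  have c1 : (Finset.Icc (0 : ℤ) (2 * n) \ (S + S)).card = 2 * n + 1 - (S + S).card := by
    rw [Finset.card_sdiff_of_subset hadd, Int.card_Icc]; omega
  have c2 : (Finset.Icc (-n : ℤ) n \ (S - S)).card = 2 * n + 1 - (S - S).card := by
    rw [Finset.card_sdiff_of_subset hsub, Int.card_Icc]; omega
  unfold missing
  rw [← c1, ← c2]
  have e1 : Finset.Icc (0 : ℤ) (2 * n) \ (S + S) = (Finset.Ico (0 : ℤ) k \ (S + S)) ∪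
      (Finset.Ico (0 : ℤ) k \ (reflect n S + reflect n S)).image (fun x => 2 * n - x) := by
    ext x
    simp only [Finset.mem_sdiff, Finset.mem_union, Finset.mem_image, mem_reflect_add_reflect,
      Finset.mem_Icc, Finset.mem_Ico]
    constructor
    · rintro ⟨hx, hxS⟩
      by_cases h1 : x < k
      · exact Or.inl ⟨by omega, hxS⟩
      by_cases h2 : x ≤ 2 * n - k
      · exact absurd (hsum x (by omega) h2) hxS
      · exact Or.inr ⟨2 * n - x, ⟨by omega, by rwa [sub_sub_cancel]⟩, by ring⟩
    · rintro (⟨hx, hxS⟩ | ⟨y, ⟨hy, hyS⟩, rfl⟩)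
      · exact ⟨by omega, hxS⟩
      · exact ⟨by omega, hyS⟩
  have e2 : Finset.Icc (-n : ℤ) n \ (S - S) =
      (Finset.Ico (0 : ℤ) k \ (S + reflect n S)).image (fun x => (n : ℤ) - x) ∪
      (Finset.Ico (0 : ℤ) k \ (S + reflect n S)).image (fun x => x - (n : ℤ)) := by
    ext x
    simp only [Finset.mem_sdiff, Finset.mem_union, Finset.mem_image, mem_add_reflect,
      Finset.mem_Icc, Finset.mem_Ico]
    constructor
    · rintro ⟨hx, hxS⟩
      rcases le_total 0 x with h0 | h0
      · by_cases h2 : x ≤ n - k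
        · exact absurd (hdiff x h0 h2) hxS
        · exact Or.inl ⟨n - x, ⟨by omega, by rwa [sub_sub_cancel]⟩, by ring⟩
      · by_cases h2 : -x ≤ n - k
        · exact absurd (neg_mem_sub_self.1 (hdiff (-x) (by omega) h2)) hxS
        · refine Or.inr ⟨x + n, ⟨by omega, ?_⟩, by ring⟩
          rwa [show (n : ℤ) - (x + n) = -x by ring, neg_mem_sub_self]
    · rintro (⟨y, ⟨hy, hyS⟩, rfl⟩ | ⟨y, ⟨hy, hyS⟩, rfl⟩)
      · exact ⟨by omega, hyS⟩
      · refine ⟨by omega, ?_⟩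
        rwa [← neg_mem_sub_self, neg_sub]
  rw [e1, e2, Finset.card_union_of_disjoint, Finset.card_union_of_disjoint,
    Finset.card_image_of_injective _ (fun a b h => by simpa using h),
    Finset.card_image_of_injective _ (fun a b h => by simpa using h),
    Finset.card_image_of_injective _ (fun a b h => by simpa using h), ← two_mul]
  · rfl
  · rw [Finset.disjoint_left]
    intro x hx hx'
    simp only [Finset.mem_sdiff, Finset.mem_image, Finset.mem_Ico] at hx hx'
    obtain ⟨y, hy, rfl⟩ := hx
    obtain ⟨z, hz, h⟩ := hx'
    omega
  · rw [Finset.disjoint_left]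
    intro x hx hx'
    simp only [Finset.mem_sdiff, Finset.mem_image, Finset.mem_Ico] at hx hx'
    obtain ⟨z, hz, h⟩ := hx'
    omega

/-- The numbers of missing sums and differences determined by two fringes. -/
noncomputable def fringeMissing (k : ℕ) (A B : Finset ℤ) : ℕ × ℕ :=
  (miss k A A + miss k B B, 2 * miss k A B)

theorem nonneg_of_mem {n : ℕ} {S : Finset ℤ} (hS : S ⊆ Finset.Icc (0 : ℤ) n) :
    (∀ x ∈ S, 0 ≤ x) ∧ ∀ x ∈ reflect n S, 0 ≤ x := by
  constructor
  · exact fun x hx => (Finset.mem_Icc.1 (hS hx)).1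
  · intro x hx
    have := Finset.mem_Icc.1 (hS (mem_reflect.1 hx))
    omega

theorem missing_eq_fringeMissing {k n : ℕ} (hk : k ≤ n) {S : Finset ℤ}
    (hS : S ⊆ Finset.Icc (0 : ℤ) n)
    (hsum : ∀ x : ℤ, k ≤ x → x ≤ 2 * n - k → x ∈ S + S)
    (hdiff : ∀ x : ℤ, 0 ≤ x → x ≤ n - k → x ∈ S - S) :
    missing n S = fringeMissing k (S ∩ Finset.Ico 0 k) (reflect n S ∩ Finset.Ico 0 k) := by
  obtain ⟨h1, h2⟩ := nonneg_of_mem hS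
  rw [missing_eq_of_central hk hS hsum hdiff, fringeMissing, miss_inter h1 h1, miss_inter h2 h2,
    miss_inter h1 h2]

theorem Rich.missing_eq {k n : ℕ} (hk : k ≤ n) {S : Finset ℤ} (hS : S ⊆ Finset.Icc (0 : ℤ) n)
    (h : Rich 0 k n S) :
    missing n S = fringeMissing k (S ∩ Finset.Ico 0 k) (reflect n S ∩ Finset.Ico 0 k) := by
  apply missing_eq_fringeMissing hk hS
  · intro x hx1 hx2
    obtain ⟨a, ha, b, hb, hab⟩ := h.1 x hx1 hx2
    exact Finset.mem_add.2 ⟨a, (Finset.mem_inter.1 ha).1, b, (Finset.mem_inter.1 hb).1, hab⟩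
  · intro x hx1 hx2
    obtain ⟨a, ha, b, hb, hab⟩ := h.2 x hx1 hx2
    exact Finset.mem_sub.2 ⟨a, (Finset.mem_inter.1 ha).1, b, (Finset.mem_inter.1 hb).1, hab⟩

/-! ### Decomposition into two fringes and a centre -/

/-- The set with lower fringe `A`, upper fringe `n - B` and central part `T`. -/
def glue (n : ℕ) (A B T : Finset ℤ) : Finset ℤ := A ∪ (T ∪ reflect n B)

section

variable {n k : ℕ} {A B T : Finset ℤ}

theorem mem_glue {x : ℤ} : x ∈ glue n A B T ↔ x ∈ A ∨ x ∈ T ∨ (n : ℤ) - x ∈ B := by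
  simp [glue, mem_reflect]

theorem glue_subset (hk : 2 * k ≤ n) (hA : A ⊆ Finset.Ico 0 (k : ℤ))
    (hB : B ⊆ Finset.Ico 0 (k : ℤ)) (hT : T ⊆ Finset.Icc (k : ℤ) (n - k)) :
    glue n A B T ⊆ Finset.Icc (0 : ℤ) n := by
  intro x hx
  rw [Finset.mem_Icc]
  rcases mem_glue.1 hx with h | h | h
  · have := Finset.mem_Ico.1 (hA h); omega
  · have := Finset.mem_Icc.1 (hT h); omega
  · have := Finset.mem_Ico.1 (hB h); omega

theorem glue_inter_low (hk : 2 * k ≤ n) (hA : A ⊆ Finset.Ico 0 (k : ℤ))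
    (hB : B ⊆ Finset.Ico 0 (k : ℤ)) (hT : T ⊆ Finset.Icc (k : ℤ) (n - k)) :
    glue n A B T ∩ Finset.Ico 0 (k : ℤ) = A := by
  ext x
  rw [Finset.mem_inter, mem_glue]
  constructor
  · rintro ⟨h | h | h, hx⟩
    · exact h
    · have := Finset.mem_Icc.1 (hT h); have := Finset.mem_Ico.1 hx; omega
    · have := Finset.mem_Ico.1 (hB h); have := Finset.mem_Ico.1 hx; omega
  · exact fun h => ⟨Or.inl h, hA h⟩

theorem reflect_glue_inter_low (hk : 2 * k ≤ n) (hA : A ⊆ Finset.Ico 0 (k : ℤ))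
    (hB : B ⊆ Finset.Ico 0 (k : ℤ)) (hT : T ⊆ Finset.Icc (k : ℤ) (n - k)) :
    reflect n (glue n A B T) ∩ Finset.Ico 0 (k : ℤ) = B := by
  ext x
  rw [Finset.mem_inter, mem_reflect, mem_glue, sub_sub_cancel]
  constructor
  · rintro ⟨h | h | h, hx⟩
    · have := Finset.mem_Ico.1 (hA h); have := Finset.mem_Ico.1 hx; omega
    · have := Finset.mem_Icc.1 (hT h); have := Finset.mem_Ico.1 hx; omega
    · exact h
  · exact fun h => ⟨Or.inr (Or.inr h), hB h⟩

theorem glue_inter_mid (hA : A ⊆ Finset.Ico 0 (k : ℤ))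
    (hB : B ⊆ Finset.Ico 0 (k : ℤ)) (hT : T ⊆ Finset.Icc (k : ℤ) (n - k)) :
    glue n A B T ∩ Finset.Icc (k : ℤ) (n - k) = T := by
  ext x
  rw [Finset.mem_inter, mem_glue]
  constructor
  · rintro ⟨h | h | h, hx⟩
    · have := Finset.mem_Ico.1 (hA h); have := Finset.mem_Icc.1 hx; omega
    · exact h
    · have := Finset.mem_Ico.1 (hB h); have := Finset.mem_Icc.1 hx; omega
  · exact fun h => ⟨Or.inr (Or.inl h), hT h⟩

end

theorem glue_self {n k : ℕ} {S : Finset ℤ} (hS : S ⊆ Finset.Icc (0 : ℤ) n) :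
    glue n (S ∩ Finset.Ico 0 (k : ℤ)) (reflect n S ∩ Finset.Ico 0 (k : ℤ))
      (S ∩ Finset.Icc (k : ℤ) (n - k)) = S := by
  ext x
  simp only [mem_glue, Finset.mem_inter, mem_reflect, sub_sub_cancel]
  constructor
  · tauto
  · intro h
    have := Finset.mem_Icc.1 (hS h)
    simp only [h, true_and, Finset.mem_Ico, Finset.mem_Icc]
    omega

open Classical in
/-- Fringes of a uniformly random subset are uniformly distributed. -/
theorem card_filter_fringe {n k : ℕ} (hk : 2 * k ≤ n) (p : Finset ℤ → Finset ℤ → Prop) :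
    ((Finset.Icc (0 : ℤ) n).powerset.filter
      (fun S => p (S ∩ Finset.Ico 0 (k : ℤ)) (reflect n S ∩ Finset.Ico 0 (k : ℤ)))).card =
    (((Finset.Ico 0 (k : ℤ)).powerset ×ˢ (Finset.Ico 0 (k : ℤ)).powerset).filter
      (fun q => p q.1 q.2)).card * 2 ^ (n + 1 - 2 * k) := by
  have hc : (Finset.Icc (k : ℤ) (n - k)).powerset.card = 2 ^ (n + 1 - 2 * k) := by
    rw [Finset.card_powerset, Int.card_Icc]
    congr 1
    omega
  rw [← hc, ← Finset.card_product]
  apply Finset.card_nbij'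
    (fun S => ((S ∩ Finset.Ico 0 (k : ℤ), reflect n S ∩ Finset.Ico 0 (k : ℤ)),
      S ∩ Finset.Icc (k : ℤ) (n - k)))
    (fun q => glue n q.1.1 q.1.2 q.2)
  · intro S hS
    simp only [Finset.coe_filter, Finset.mem_powerset, Set.mem_ofPred_eq] at hS
    simp only [Finset.coe_product, Set.mem_prod, Finset.mem_coe, Finset.mem_filter,
      Finset.mem_product, Finset.mem_powerset, Finset.inter_subset_right, hS.2, true_and]
  · rintro ⟨⟨A, B⟩, T⟩ hq
    simp only [Finset.coe_product, Set.mem_prod, Finset.mem_coe, Finset.mem_filter,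
      Finset.mem_product, Finset.mem_powerset] at hq
    obtain ⟨⟨⟨hA, hB⟩, hp⟩, hT⟩ := hq
    simp only [Finset.coe_filter, Finset.mem_powerset, Set.mem_ofPred_eq]
    rw [glue_inter_low hk hA hB hT, reflect_glue_inter_low hk hA hB hT]
    exact ⟨glue_subset hk hA hB hT, hp⟩
  · intro S hS
    simp only [Finset.coe_filter, Finset.mem_powerset, Set.mem_ofPred_eq] at hS
    exact glue_self hS.1
  · rintro ⟨⟨A, B⟩, T⟩ hq
    simp only [Finset.coe_product, Set.mem_prod, Finset.mem_coe, Finset.mem_filter,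
      Finset.mem_product, Finset.mem_powerset] at hq
    obtain ⟨⟨⟨hA, hB⟩, hp⟩, hT⟩ := hq
    simp only [glue_inter_low hk hA hB hT, reflect_glue_inter_low hk hA hB hT,
      glue_inter_mid hA hB hT]

/-! ### Existence of the limit -/

open Classical in
/-- The probability that two random fringes of length `k` have missing numbers in `Λ`. -/
noncomputable def fringeRho (Λ : Set (ℕ × ℕ)) (k : ℕ) : ℝ :=
  ((((Finset.Ico 0 (k : ℤ)).powerset ×ˢ (Finset.Ico 0 (k : ℤ)).powerset).filter
      (fun q => fringeMissing k q.1 q.2 ∈ Λ)).card : ℝ) / 2 ^ (2 * k)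

open Classical in
theorem fringeRho_eq (Λ : Set (ℕ × ℕ)) {n k : ℕ} (hk : 2 * k ≤ n) :
    fringeRho Λ k = (((Finset.Icc (0 : ℤ) n).powerset.filter
      (fun S => fringeMissing k (S ∩ Finset.Ico 0 (k : ℤ)) (reflect n S ∩ Finset.Ico 0 (k : ℤ)) ∈ Λ)).card
        : ℝ) / 2 ^ (n + 1) := by
  rw [card_filter_fringe hk (fun A B => fringeMissing k A B ∈ Λ), fringeRho,
    div_eq_div_iff (by positivity) (by positivity),
    show (2 : ℝ) ^ (n + 1) = 2 ^ (n + 1 - 2 * k) * 2 ^ (2 * k) by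
      rw [← pow_add]; congr 1; omega]
  push_cast
  ring

open Classical in
/-- Compare two events that agree on sets without central gaps. -/
theorem card_filter_div_le {n k : ℕ} (hk : k ≤ n) {p q : Finset ℤ → Prop}
    (h : ∀ S ⊆ Finset.Icc (0 : ℤ) n, Rich 0 k n S → p S → q S) :
    (((Finset.Icc (0 : ℤ) n).powerset.filter p).card : ℝ) / 2 ^ (n + 1) ≤
      (((Finset.Icc (0 : ℤ) n).powerset.filter q).card : ℝ) / 2 ^ (n + 1) + 30 * (9 / 10) ^ k := by
  have hb := card_not_rich_le 0 k n (by omega) hk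
  have hle : ((Finset.Icc (0 : ℤ) n).powerset.filter p).card ≤
      ((Finset.Icc (0 : ℤ) n).powerset.filter q).card +
      ((Finset.Icc (0 : ℤ) n).powerset.filter (fun S => ¬ Rich 0 k n S)).card := by
    refine (Finset.card_le_card fun S hS => ?_).trans (Finset.card_union_le _ _)
    simp only [Finset.mem_union, Finset.mem_filter] at hS ⊢
    by_cases hR : Rich 0 k n S
    · exact Or.inl ⟨hS.1, h S (Finset.mem_powerset.1 hS.1) hR hS.2⟩
    · exact Or.inr ⟨hS.1, hR⟩
  have hle' : (((Finset.Icc (0 : ℤ) n).powerset.filter p).card : ℝ) ≤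
      ((Finset.Icc (0 : ℤ) n).powerset.filter q).card +
      ((Finset.Icc (0 : ℤ) n).powerset.filter (fun S => ¬ Rich 0 k n S)).card := by
    exact_mod_cast hle
  simp only [mul_zero, Nat.sub_zero] at hb
  rw [div_le_iff₀ (by positivity), add_mul, div_mul_cancel₀ _ (by positivity)]
  linarith

theorem abs_rhoN_sub_fringeRho_le (Λ : Set (ℕ × ℕ)) {n k : ℕ} (hk : 2 * k ≤ n) :
    |rhoN Λ n - fringeRho Λ k| ≤ 30 * (9 / 10) ^ k := by
  classical
  rw [fringeRho_eq Λ hk, abs_sub_le_iff, sub_le_iff_le_add', sub_le_iff_le_add']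
  constructor
  · exact card_filter_div_le (by omega) fun S hS hR h => by rwa [← hR.missing_eq (by omega) hS]
  · exact card_filter_div_le (by omega) fun S hS hR h => by
      rwa [← hR.missing_eq (by omega) hS] at h

theorem tendsto_tail_bound : Tendsto (fun k : ℕ => 30 * (9 / 10 : ℝ) ^ k) atTop (𝓝 0) := by
  simpa using (tendsto_pow_atTop_nhds_zero_of_lt_one (r := (9 / 10 : ℝ)) (by norm_num)
    (by norm_num)).const_mul 30

theorem tendsto_rhoN (Λ : Set (ℕ × ℕ)) : Tendsto (rhoN Λ) atTop (𝓝 (rho Λ)) := by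
  apply tendsto_nhds_limUnder
  apply cauchySeq_tendsto_of_complete
  rw [Metric.cauchySeq_iff']
  intro ε hε
  obtain ⟨k, hk⟩ := (tendsto_tail_bound.eventually (gt_mem_nhds (half_pos hε))).exists
  -- Both `rhoN Λ n` and `rhoN Λ (2 * k)` are close to the same fringe probability, which does not
  -- involve `n`.
  refine ⟨2 * k, fun n hn => ?_⟩
  have h1 := abs_rhoN_sub_fringeRho_le Λ hn
  have h2 := abs_rhoN_sub_fringeRho_le Λ (le_refl (2 * k))
  rw [abs_sub_comm] at h2
  rw [Real.dist_eq]
  have := abs_sub_le (rhoN Λ n) (fringeRho Λ k) (rhoN Λ (2 * k))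
  linarith

/-! ### Countable additivity -/

theorem rhoN_mono {Λ Λ' : Set (ℕ × ℕ)} (h : Λ ⊆ Λ') (n : ℕ) : rhoN Λ n ≤ rhoN Λ' n := by
  classical
  unfold rhoN
  gcongr

theorem rho_mono {Λ Λ' : Set (ℕ × ℕ)} (h : Λ ⊆ Λ') : rho Λ ≤ rho Λ' :=
  le_of_tendsto_of_tendsto' (tendsto_rhoN Λ) (tendsto_rhoN Λ') (rhoN_mono h)

theorem rho_nonneg (Λ : Set (ℕ × ℕ)) : 0 ≤ rho Λ :=
  ge_of_tendsto' (tendsto_rhoN Λ) fun n => by unfold rhoN; positivity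

theorem rho_coe_finset (F : Finset (ℕ × ℕ)) : rho (F : Set (ℕ × ℕ)) = ∑ p ∈ F, rho {p} := by
  classical
  refine tendsto_nhds_unique (tendsto_rhoN _) ?_
  have h : rhoN (F : Set (ℕ × ℕ)) = fun n => ∑ p ∈ F, rhoN {p} n := by
    funext n
    unfold rhoN
    rw [← Finset.sum_div, ← Nat.cast_sum]
    congr 2
    refine (Finset.card_eq_sum_card_fiberwise (f := missing n) (t := F)
      (fun S hS => ?_)).trans ?_
    · simp only [Finset.coe_filter, Set.mem_ofPred_eq] at hS
      exact hS.2
    refine Finset.sum_congr rfl fun p hp => ?_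
    rw [Finset.filter_filter]
    congr 1
    ext S
    simp only [Finset.mem_filter, Set.mem_singleton_iff, Finset.mem_coe]
    exact and_congr_right fun _ => ⟨fun h => h.2, fun h => ⟨h ▸ hp, h⟩⟩
  rw [h]
  exact tendsto_finsetSum _ fun p _ => tendsto_rhoN {p}

/-- Tightness: a set without central gaps misses at most `k` values at each end, so the mass outside
a finite box is exponentially small. -/
theorem rho_le_rho_inter_add (Λ : Set (ℕ × ℕ)) (k : ℕ) :
    rho Λ ≤ rho (Λ ∩ Set.Iic (2 * k, 2 * k)) + 30 * (9 / 10) ^ k := by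
  classical
  refine le_of_tendsto_of_tendsto (tendsto_rhoN Λ) ((tendsto_rhoN _).add_const _) ?_
  filter_upwards [eventually_ge_atTop k] with n hn
  refine card_filter_div_le hn fun S hS hR h => ⟨h, ?_⟩
  rw [hR.missing_eq hn hS, Set.mem_Iic, Prod.mk_le_mk]
  have := miss_le k
  refine ⟨?_, ?_⟩
  · rw [two_mul]; exact add_le_add (this _ _) (this _ _)
  · exact Nat.mul_le_mul_left _ (this _ _)

/-- The terms are nonnegative, so it suffices that `rho Λ` is the supremum of the finite partial
sums. Monotonicity bounds them above; the finite boxes from tightness show that the bound is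
approached. -/
theorem hasSum_rho (Λ : Set (ℕ × ℕ)) : HasSum (fun p : Λ => rho {(p : ℕ × ℕ)}) (rho Λ) := by
  classical
  have hsum : ∀ F : Finset Λ, ∑ p ∈ F, rho {(p : ℕ × ℕ)} =
      rho (F.map (Function.Embedding.subtype _) : Finset (ℕ × ℕ)) := fun F => by
    rw [rho_coe_finset, Finset.sum_map]
    rfl
  refine hasSum_of_isLUB_of_nonneg _ (fun p => rho_nonneg _) ⟨?_, fun b hb => ?_⟩
  · rintro _ ⟨F, rfl⟩
    simp only [hsum]
    apply rho_mono
    intro p hp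
    simp only [Finset.coe_map, Set.mem_image] at hp
    obtain ⟨q, -, rfl⟩ := hp
    exact q.2
  · refine ge_of_tendsto' (by simpa using tendsto_tail_bound.const_add b) fun k => ?_
    refine (rho_le_rho_inter_add Λ k).trans (add_le_add_left ?_ _)
    refine le_trans ?_ (hb ⟨(Finset.Iic (2 * k, 2 * k)).subtype (· ∈ Λ), rfl⟩)
    simp only [hsum]
    apply rho_mono
    rintro p ⟨hp, hpk⟩
    simp only [Finset.coe_map, Set.mem_image]
    exact ⟨⟨p, hp⟩, by simpa using hpk, rfl⟩

/-! ### Positivity -/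

theorem trace_subset (k : ℕ) (A : Set ℕ) : trace k A ⊆ Finset.Ico 0 (k : ℤ) := by
  classical exact Finset.filter_subset _ _

theorem mem_trace {k : ℕ} {A : Set ℕ} {x : ℤ} : x ∈ trace k A ↔ (0 ≤ x ∧ x < k) ∧ x.toNat ∈ A := by
  simp [trace]

theorem trace_inter {N K : ℕ} (h : N ≤ K) (A : Set ℕ) :
    trace K A ∩ Finset.Ico 0 (N : ℤ) = trace N A := by
  ext x
  simp only [Finset.mem_inter, mem_trace, Finset.mem_Ico]
  constructor
  · rintro ⟨⟨_, h1⟩, h2⟩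
    exact ⟨h2, h1⟩
  · rintro ⟨h1, h2⟩
    exact ⟨⟨by omega, h2⟩, h1⟩

/-- Replacing the outer parts of a set without central gaps by prescribed fringes. -/
theorem missing_glue_trace {N K n : ℕ} (hNK : 2 * N ≤ K) (hn : 2 * K ≤ n) {A B : Set ℕ}
    (hA : 0 ∈ A) (hB : 0 ∈ B) (hAB : ∀ x ≥ N, x ∈ A ∧ x ∈ B) {S : Finset ℤ} (hR : Rich N K n S) :
    missing n (glue n (trace K A) (trace K B) (S ∩ Finset.Icc (K : ℤ) (n - K))) =
      fringeMissing N (trace N A) (trace N B) := by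
  have hT : S ∩ Finset.Icc (K : ℤ) (n - K) ⊆ Finset.Icc (K : ℤ) (n - K) := Finset.inter_subset_right
  have hlow := glue_inter_low hn (trace_subset K A) (trace_subset K B) hT
  have hhigh := reflect_glue_inter_low hn (trace_subset K A) (trace_subset K B) hT
  have hsub := glue_subset hn (trace_subset K A) (trace_subset K B) hT
  -- No element of `S` in `[N, n - N]` is lost, because the new fringes are full from `N` to `K`.
  -- This is why `Rich` restricts the summands to that interval.
  have hmem : ∀ x ∈ S ∩ Finset.Icc (N : ℤ) (n - N),
      x ∈ glue n (trace K A) (trace K B) (S ∩ Finset.Icc (K : ℤ) (n - K)) := by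
    intro x hx
    rw [Finset.mem_inter, Finset.mem_Icc] at hx
    rw [mem_glue, mem_trace, mem_trace, Finset.mem_inter, Finset.mem_Icc]
    by_cases h1 : x < K
    · exact Or.inl ⟨by omega, (hAB _ (by omega)).1⟩
    by_cases h2 : x ≤ n - K
    · exact Or.inr (Or.inl ⟨hx.1, by omega, h2⟩)
    · exact Or.inr (Or.inr ⟨by omega, (hAB _ (by omega)).2⟩)
  have hmemA : ∀ x : ℤ, x = 0 ∨ N ≤ x → x < K → x ∈ trace K A ∧ x ∈ trace K B := by
    intro x hx hxK
    rw [mem_trace, mem_trace]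
    rcases hx with rfl | hx
    · exact ⟨⟨by omega, hA⟩, ⟨by omega, hB⟩⟩
    · exact ⟨⟨by omega, (hAB _ (by omega)).1⟩, ⟨by omega, (hAB _ (by omega)).2⟩⟩
  have hL : ∀ x : ℤ, x = 0 ∨ N ≤ x → x < K →
      x ∈ glue n (trace K A) (trace K B) (S ∩ Finset.Icc (K : ℤ) (n - K)) :=
    fun x hx hxK => mem_glue.2 (Or.inl (hmemA x hx hxK).1)
  have hH : ∀ x : ℤ, x = 0 ∨ N ≤ x → x < K →
      n - x ∈ glue n (trace K A) (trace K B) (S ∩ Finset.Icc (K : ℤ) (n - K)) :=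
    fun x hx hxK => mem_glue.2 (Or.inr (Or.inr (by
      rw [sub_sub_cancel]; exact (hmemA x hx hxK).2)))
  rw [missing_eq_fringeMissing (k := N) (by omega) hsub]
  · have hI : Finset.Ico 0 (N : ℤ) = Finset.Ico 0 (K : ℤ) ∩ Finset.Ico 0 (N : ℤ) := by
      rw [Finset.Ico_inter_Ico]
      congr 1
      simp; omega
    rw [hI, ← Finset.inter_assoc, hlow, ← Finset.inter_assoc, hhigh, trace_inter (by omega),
      trace_inter (by omega)]
  · intro x hx1 hx2
    rw [Finset.mem_add]
    by_cases h1 : x < K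
    -- Sums between `N` and `K` come from `0` plus a fringe element; the upper end and the large
    -- differences use the endpoints `n` and `0` likewise.
    · exact ⟨0, hL 0 (Or.inl rfl) (by omega), x, hL x (Or.inr hx1) h1, by ring⟩
    by_cases h2 : x ≤ 2 * n - K
    · obtain ⟨a, ha, b, hb, hab⟩ := hR.1 x (by omega) h2
      exact ⟨a, hmem a ha, b, hmem b hb, hab⟩
    · exact ⟨n - 0, hH 0 (Or.inl rfl) (by omega), n - (2 * n - x),
        hH _ (Or.inr (by omega)) (by omega), by ring⟩
  · intro x hx1 hx2
    rw [Finset.mem_sub]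
    by_cases h2 : x ≤ n - K
    · obtain ⟨a, ha, b, hb, hab⟩ := hR.2 x hx1 h2
      exact ⟨a, hmem a ha, b, hmem b hb, hab⟩
    · exact ⟨n - (n - x), hH _ (Or.inr (by omega)) (by omega), 0,
        hL 0 (Or.inl rfl) (by omega), by ring⟩

theorem rho_pos {Λ : Set (ℕ × ℕ)} {s t : ℕ} (hΛ : (s, 2 * t) ∈ Λ) : 0 < rho Λ := by
  classical
  obtain ⟨N, A, B, hA, hB, hAB, hs, h0, ht⟩ := exists_fringe s t
  obtain ⟨j, hj⟩ := (tendsto_tail_bound.eventually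
    (gt_mem_nhds (show (0 : ℝ) < 1 / 2 by norm_num))).exists
  set K := 2 * N + j with hK
  refine lt_of_lt_of_le (show (0 : ℝ) < 1 / 2 / 2 ^ (2 * K) by positivity)
    -- More than half of all sets are rich, and grafting merges at most `2^(2K)` of them into one,
    -- which gives the lower bound `1 / 2 / 2^(2K)`.
    (ge_of_tendsto (tendsto_rhoN _) ?_)
  filter_upwards [eventually_ge_atTop (2 * K)] with n hn
  have hbad := card_not_rich_le N K n (by omega) (by omega)
  have hsplit := Finset.card_filter_add_card_filter_not
    (s := (Finset.Icc (0 : ℤ) n).powerset) (Rich N K n)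
  have htot : (Finset.Icc (0 : ℤ) n).powerset.card = 2 ^ (n + 1) := by
    rw [Finset.card_powerset, Int.card_Icc]; congr 1
  rw [htot] at hsplit
  have hsplit' : (((Finset.Icc (0 : ℤ) n).powerset.filter (Rich N K n)).card : ℝ) +
      ((Finset.Icc (0 : ℤ) n).powerset.filter (fun S => ¬ Rich N K n S)).card = 2 ^ (n + 1) := by
    exact_mod_cast hsplit
  have hinj : ((Finset.Icc (0 : ℤ) n).powerset.filter (Rich N K n)).card ≤
      (((Finset.Icc (0 : ℤ) n).powerset.filter
        (fun S => missing n S ∈ Λ)) ×ˢ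
        ((Finset.Ico 0 (K : ℤ)).powerset ×ˢ (Finset.Ico 0 (K : ℤ)).powerset)).card := by
    -- Recording the two discarded fringes beside the grafted set makes grafting injective.
    apply Finset.card_le_card_of_injOn
      (fun S => (glue n (trace K A) (trace K B) (S ∩ Finset.Icc (K : ℤ) (n - K)),
        (S ∩ Finset.Ico 0 (K : ℤ), reflect n S ∩ Finset.Ico 0 (K : ℤ))))
    · intro S hS
      simp only [Finset.coe_filter, Set.mem_ofPred_eq] at hS
      simp only [Finset.coe_product, Set.mem_prod, Finset.mem_coe, Finset.mem_filter,
        Finset.mem_powerset, Finset.inter_subset_right, and_true]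
      refine ⟨glue_subset hn (trace_subset K A) (trace_subset K B) Finset.inter_subset_right, ?_⟩
      rw [missing_glue_trace (by omega) hn hA hB hAB hS.2, fringeMissing, hs, h0, ht, add_zero]
      exact hΛ
    · intro S hS S' hS' h
      simp only [Finset.coe_filter, Finset.mem_powerset, Set.mem_ofPred_eq] at hS hS'
      simp only [Prod.mk.injEq] at h
      have h1 := congrArg (· ∩ Finset.Icc (K : ℤ) (n - K)) h.1
      simp only [glue_inter_mid (trace_subset K A) (trace_subset K B)
        Finset.inter_subset_right] at h1
      rw [← glue_self (k := K) hS.1, ← glue_self (k := K) hS'.1, h.2.1, h.2.2, h1]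
  have hpow : (Finset.Ico 0 (K : ℤ)).powerset.card = 2 ^ K := by
    rw [Finset.card_powerset, Int.card_Ico]; congr 1
  rw [Finset.card_product, Finset.card_product, hpow, ← pow_add, ← two_mul] at hinj
  have hinj' : (((Finset.Icc (0 : ℤ) n).powerset.filter (Rich N K n)).card : ℝ) ≤
      ((Finset.Icc (0 : ℤ) n).powerset.filter
        (fun S => missing n S ∈ Λ)).card * 2 ^ (2 * K) := by
    exact_mod_cast hinj
  have hj' : (2 : ℝ) ^ (n + 1) * (30 * (9 / 10) ^ (K - 2 * N)) ≤ 2 ^ (n + 1) * (1 / 2) := by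
    rw [show K - 2 * N = j by omega]
    gcongr
  unfold rhoN
  rw [div_le_div_iff₀ (by positivity) (by positivity)]
  linarith

theorem theorem2 (Λ : Set (ℕ × ℕ)) :
    Tendsto (rhoN Λ) atTop (𝓝 (rho Λ)) ∧
    ((∃ s d : ℕ, (s, d) ∈ Λ ∧ Even d) → 0 < rho Λ) ∧
    HasSum (fun p : Λ => rho {(p : ℕ × ℕ)}) (rho Λ) := by
  refine ⟨tendsto_rhoN Λ, ?_, hasSum_rho Λ⟩
  rintro ⟨s, d, hΛ, t, rfl⟩
  rw [← two_mul] at hΛ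
  exact rho_pos hΛ
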